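/- Let $p\ge 9$ be real and let $e^{ir\partial_x^2}$ denote the free Schrödinger group on $L^2(\mathbb R)=L^2(\mathbb R;\mathbb C)$. For $0\ne f\in H^1(\mathbb R)$ put $$W_p(f)=\frac{\|e^{ir\partial_x^2}f\|_{L^{p+1}_{r,x}}^{p+1}}{\|f\|_{L^2}^{\frac{p+7}{2}}\,\|\partial_xf\|_{L^2}^{\frac{p-5}{2}}},\qquad \|u\|_{L^{q}_{r,x}}^{q}=\int_{\mathbb R}\int_{\mathbb R}|u(r,x)|^{q}\,dx\,dr,\qquad \mathcal C_p=\sup_{0\neq f\in H^1(\mathbb R)}W_p(f).$$ A maximizer for $\mathcal C_p$ is a nonzero $Q\in H^1(\mathbb R)$ with $W_p(Q)=\mathcal C_p$. Let $Q$ be a maximizer for $\mathcal C_p$ which solves the Euler–Lagrange equation $$-\partial_x^2Q+Q-\int_{\mathbb R}e^{-ir\partial_x^2}\big(|e^{ir\partial_x^2}Q|^{p-1}e^{ir\partial_x^2}Q\big)\,dr=0$$ in the sense of distributions, the integral being an $L^2(\mathbb R)$-valued (Bochner) integral. Then $0<\mathcal C_p<\infty$ and $$\|Q\|_{L^2}^2=\left[\frac{2(p+1)(p-5)}{(p+7)^2\,\mathcal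 C_p}\right]^{\frac{2}{p-1}}\left(\frac{p+7}{p-5}\right)^{\frac12},\qquad \|\partial_xQ\|_{L^2}^2=\frac{p-5}{p+7}\,\|Q\|_{L^2}^2,$$ $$\|e^{ir\partial_x^2}Q\|_{L^{p+1}_{r,x}}^{p+1}=\frac{2(p+1)}{p+7}\,\|Q\|_{L^2}^2.$$ Consequently, the three quantities $\|Q\|_{L^2}$, $\|\partial_xQ\|_{L^2}$ and $\|e^{ir\partial_x^2}Q\|_{L^{p+1}_{r,x}}^{p+1}$ are the same for all maximizers $Q$ for $\mathcal C_p$ that solve this equation. -/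

import Mathlib

noncomputable section

namespace GNStrichartz

open MeasureTheory FourierTransform
open scoped ENNReal SchwartzMap LineDeriv

/-- The complex Hilbert space `L²(ℝ)`. -/
abbrev L2 : Type := Lp ℂ 2 (volume : Measure ℝ)

/-- `f ∈ H¹(ℝ)`, for `f ∈ L²(ℝ)`. -/
def MemH1 (f : L2) : Prop :=
  TemperedDistribution.MemSobolev 1 2 (f : 𝓢'(ℝ, ℂ))

open Classical in
/-- The distributional derivative `∂ₓ f` as an element of `L²(ℝ)`, for `f ∈ H¹(ℝ)`
(and `0` if the distributional derivative is not an `L²` function). -/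
def dx (f : L2) : L2 :=
  if h : ∃ g : L2, ∂_{(1 : ℝ)} (f : 𝓢'(ℝ, ℂ)) = (g : 𝓢'(ℝ, ℂ)) then h.choose else 0

/-- On `H¹(ℝ)`, `dx f` is the distributional derivative of `f`. -/
theorem dx_spec {f : L2} (hf : MemH1 f) :
    ∂_{(1 : ℝ)} (f : 𝓢'(ℝ, ℂ)) = (dx f : 𝓢'(ℝ, ℂ)) := by
  have h : ∃ g : L2, ∂_{(1 : ℝ)} (f : 𝓢'(ℝ, ℂ)) = (g : 𝓢'(ℝ, ℂ)) := by
    have h1 := TemperedDistribution.MemSobolev.lineDerivOp (m := (1 : ℝ)) hf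
    rw [sub_self] at h1
    exact TemperedDistribution.memSobolev_zero_iff.1 h1
  rw [dx, dif_pos h]
  exact h.choose_spec

/-- The symbol `ξ ↦ exp (-i r (2πξ)²)` of `e^{ir∂ₓ²}`; the Fourier transform is
`𝓕 f ξ = ∫ exp (-2πixξ) f(x) dx`, so that `∂ₓ²` has the symbol `-(2πξ)²`. -/
def symbol (r : ℝ) (ξ : ℝ) : ℂ :=
  Complex.exp (-(Complex.I * r * (2 * Real.pi * ξ) ^ 2))

theorem memLp_symbol (r : ℝ) : MemLp (symbol r) ∞ (volume : Measure ℝ) := by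
  refine memLp_top_of_bound (C := 1) ?_ (Filter.Eventually.of_forall fun ξ => ?_)
  · exact Continuous.aestronglyMeasurable (by unfold symbol; fun_prop)
  · have : -(Complex.I * r * (2 * Real.pi * ξ) ^ 2)
        = ((-(r * (2 * Real.pi * ξ) ^ 2) : ℝ) : ℂ) * Complex.I := by
      push_cast; ring
    rw [symbol, this, Complex.norm_exp_ofReal_mul_I]

/-- The free Schrödinger propagator `e^{ir∂ₓ²}` on `L²(ℝ)`. -/
def propagator (r : ℝ) (f : L2) : L2 :=
  𝓕⁻ (((memLp_symbol r).toLp (symbol r) • 𝓕 f : L2))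

/-- The space-time norm `‖e^{ir∂ₓ²} f‖_{L^{p+1}_{r,x}}^{p+1} ∈ [0, ∞]`. -/
def strichartz (p : ℝ) (f : L2) : ℝ≥0∞ :=
  ∫⁻ r : ℝ, ∫⁻ x : ℝ, ‖propagator r f x‖ₑ ^ (p + 1)

/-- The Weinstein functional `W_p`. For `f ∈ H¹(ℝ)`, `f ≠ 0`, the denominator is positive and
finite. -/
def weinstein (p : ℝ) (f : L2) : ℝ≥0∞ :=
  strichartz p f / (‖f‖ₑ ^ ((p + 7) / 2) * ‖dx f‖ₑ ^ ((p - 5) / 2))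

/-- The supremum `C_p` of the Weinstein functional over `H¹(ℝ) \ {0}`. -/
def bestConst (p : ℝ) : ℝ≥0∞ :=
  ⨆ f ∈ {f : L2 | MemH1 f ∧ f ≠ 0}, weinstein p f

/-- `Q` is a maximizer for the variational problem `C_p`. -/
def IsMaximizer (p : ℝ) (Q : L2) : Prop :=
  MemH1 Q ∧ Q ≠ 0 ∧ weinstein p Q = bestConst p

open Classical in
/-- The power nonlinearity `|u|^{p-1} u`, as an element of `L²(ℝ)` (and `0` if it is not in
`L²(ℝ)`, which does not happen for `u ∈ H¹(ℝ)` and `p ≥ 1`, since then `u` is bounded). -/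
def power (p : ℝ) (u : L2) : L2 :=
  if h : MemLp (fun x => ((‖u x‖ ^ (p - 1) : ℝ) : ℂ) * u x) 2 (volume : Measure ℝ)
  then h.toLp _ else 0

/-- The averaged nonlinearity `∫_ℝ e^{-ir∂ₓ²} (|e^{ir∂ₓ²} Q|^{p-1} e^{ir∂ₓ²} Q) dr`, an
`L²(ℝ)`-valued integral. -/
def nonlinearity (p : ℝ) (Q : L2) : L2 :=
  ∫ r : ℝ, propagator (-r) (power p (propagator r Q))

/-- `Q` solves `-∂ₓ² Q + Q - ∫_ℝ e^{-ir∂ₓ²} (|e^{ir∂ₓ²} Q|^{p-1} e^{ir∂ₓ²} Q) dr = 0` (in the sense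
of distributions, all terms but the first one being in `L²(ℝ)`). -/
def SolvesEulerLagrange (p : ℝ) (Q : L2) : Prop :=
  -∂_{(1 : ℝ)} (∂_{(1 : ℝ)} (Q : 𝓢'(ℝ, ℂ))) + (Q : 𝓢'(ℝ, ℂ))
    - (nonlinearity p Q : 𝓢'(ℝ, ℂ)) = 0

end GNStrichartz

end

noncomputable section

namespace GNStrichartz

open MeasureTheory FourierTransform TemperedDistribution
open scoped ENNReal SchwartzMap LineDeriv ComplexInnerProductSpace

/-! ### Fourier characterizations -/

/-! Write N for the averaged nonlinearity and S for Re⟪Q, N⟫, which is the space-time norm of Q.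
Pairing the equation with Q gives S = ‖Q‖² + ‖∂ₓQ‖². Maximality gives, for every f in H¹, a first
variation identity (`first_variation`); since N - Q = -∂ₓ²Q, it reads aQ + b(N - Q) = 0 with
explicit real a, b. On the Fourier side (a + b(2πξ)²) 𝓕Q = 0, so a = b = 0
(`eq_zero_of_linear_relation`). From a = 0 comes S, then the pairing gives ‖∂ₓQ‖, and W_p(Q) = C_p
gives ‖Q‖.

Two analytic inputs are avoided. No Strichartz estimate is needed for C_p < ∞: the equation forces
the Bochner integral N to converge (`SolvesEulerLagrange.integrable`), so S and hence C_p = W_p(Q)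
are finite. The space-time norm is not differentiated: convexity bounds it below by its tangent line
at Q (`le_strichartz_add`), and maximality bounds it above by a differentiable function that touches
this line at Q. -/

open scoped ContDiff in
theorem ae_eq_of_integral_schwartz_smul_eq {f g : ℝ → ℂ}
    (hf : LocallyIntegrable f) (hg : LocallyIntegrable g)
    (h : ∀ u : 𝓢(ℝ, ℂ), ∫ x, u x • f x = ∫ x, u x • g x) : f =ᵐ[volume] g := by
  refine ae_eq_of_integral_contDiff_smul_eq hf hg fun u hu hc => ?_
  have h₁ : HasCompactSupport (Complex.ofRealCLM ∘ u) := hc.comp_left rfl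
  have h₂ : ContDiff ℝ ∞ (Complex.ofRealCLM ∘ u) := by fun_prop
  simpa using h (h₁.toSchwartzMap h₂)

theorem L2.locallyIntegrable (f : L2) : LocallyIntegrable (f : ℝ → ℂ) :=
  (Lp.memLp f).locallyIntegrable one_le_two

theorem toTemperedDistribution_injective :
    Function.Injective (fun f : L2 => (f : 𝓢'(ℝ, ℂ))) :=
  LinearMap.ker_eq_bot.1 (Lp.ker_toTemperedDistributionCLM_eq_bot (F := ℂ) (μ := volume) (p := 2))

/-- The bridge from identities between distributions to a.e. identities between L² Fourier
transforms. -/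
theorem smulLeftCLM_eq_iff {m : ℝ → ℂ} (hm : m.HasTemperateGrowth) (f g : L2) :
    smulLeftCLM ℂ m (f : 𝓢'(ℝ, ℂ)) = (g : 𝓢'(ℝ, ℂ)) ↔ ∀ᵐ ξ, g ξ = m ξ * f ξ := by
  have key : ∀ u : 𝓢(ℝ, ℂ), smulLeftCLM ℂ m (f : 𝓢'(ℝ, ℂ)) u = ∫ ξ, u ξ • (m ξ * f ξ) := by
    intro u
    rw [smulLeftCLM_apply_apply, Lp.toTemperedDistribution_apply]
    congr 1 with ξ
    simp [SchwartzMap.smulLeftCLM_apply_apply hm]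
    ring
  constructor
  · intro h
    refine ae_eq_of_integral_schwartz_smul_eq (L2.locallyIntegrable g) ?_ fun u => ?_
    · exact (L2.locallyIntegrable f).continuous_mul hm.1.continuous
    · rw [← key, h, Lp.toTemperedDistribution_apply]
  · intro h
    ext u
    rw [key, Lp.toTemperedDistribution_apply]
    refine integral_congr_ae ?_
    filter_upwards [h] with ξ hξ
    rw [hξ]

theorem memH1_iff (f : L2) : MemH1 f ↔
    ∃ g : L2, ∀ᵐ ξ : ℝ, g ξ = (((1 + ‖ξ‖ ^ 2) ^ (1 / 2 : ℝ) : ℝ) : ℂ) * (𝓕 f : L2) ξ := by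
  rw [MemH1, memSobolev_iff_exists_smulLeftCLM_fourier, Lp.fourier_toTemperedDistribution_eq]
  refine exists_congr fun g => ?_
  exact smulLeftCLM_eq_iff (m := fun x : ℝ => (((1 + ‖x‖ ^ 2) ^ (1 / 2 : ℝ) : ℝ) : ℂ))
    (by fun_prop) _ _

/-- The symbol of `∂ₓ`. -/
def derivSymbol (ξ : ℝ) : ℂ := 2 * Real.pi * Complex.I * ξ

theorem derivSymbol_hasTemperateGrowth : derivSymbol.HasTemperateGrowth := by
  unfold derivSymbol
  fun_prop

theorem fourier_lineDerivOp (T : 𝓢'(ℝ, ℂ)) :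
    𝓕 (∂_{(1 : ℝ)} T) = smulLeftCLM ℂ derivSymbol (𝓕 T) := by
  rw [fourier_lineDerivOp_eq, ← smul_apply, ← smulLeftCLM_smul (by fun_prop)]
  congr 2
  ext ξ
  simp [derivSymbol]

theorem fourier_dx {f : L2} (hf : MemH1 f) :
    ∀ᵐ ξ, (𝓕 (dx f) : L2) ξ = derivSymbol ξ * (𝓕 f : L2) ξ := by
  rw [← smulLeftCLM_eq_iff derivSymbol_hasTemperateGrowth,
    ← Lp.fourier_toTemperedDistribution_eq, ← Lp.fourier_toTemperedDistribution_eq,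
    ← fourier_lineDerivOp, dx_spec hf]

theorem fourier_injective {f g : L2} (h : (𝓕 f : L2) = 𝓕 g) : f = g :=
  (Lp.fourierTransformₗᵢ ℝ ℂ).injective h

theorem memH1_add {f g : L2} (hf : MemH1 f) (hg : MemH1 g) : MemH1 (f + g) := by
  have := MemSobolev.add hf hg
  rwa [← Lp.toTemperedDistributionCLM_apply, ← Lp.toTemperedDistributionCLM_apply,
    ← map_add] at this

theorem memH1_smul {f : L2} (hf : MemH1 f) (c : ℂ) : MemH1 (c • f) := by
  have := MemSobolev.smul c hf
  rwa [← Lp.toTemperedDistributionCLM_apply, ← map_smul] at this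

theorem memH1_toLp (f : 𝓢(ℝ, ℂ)) : MemH1 (f.toLp 2) := by
  rw [MemH1, Lp.toTemperedDistribution_toLp_eq]
  exact f.memSobolev

theorem dx_add_smul {f g : L2} (hf : MemH1 f) (hg : MemH1 g) (c : ℂ) :
    dx (f + c • g) = dx f + c • dx g := by
  apply toTemperedDistribution_injective
  have h := dx_spec (memH1_add hf (memH1_smul hg c))
  beta_reduce
  rw [← h]
  simp only [← Lp.toTemperedDistributionCLM_apply, map_add, map_smul]
  simp only [LineDeriv.lineDerivOp_add, LineDeriv.lineDerivOp_smul,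
    Lp.toTemperedDistributionCLM_apply, dx_spec hf, dx_spec hg]

theorem eq_zero_of_ae_mul_eq_zero {f : L2} {m : ℝ → ℂ} (hm : ∀ᵐ ξ, m ξ ≠ 0)
    (h : ∀ᵐ ξ, m ξ * (𝓕 f : L2) ξ = 0) : f = 0 := by
  apply fourier_injective
  rw [show (𝓕 (0 : L2) : L2) = 0 from (Lp.fourierTransformₗᵢ ℝ ℂ).map_zero]
  ext1
  filter_upwards [hm, h, Lp.coeFn_zero ℂ 2 (volume : Measure ℝ)] with ξ h1 h2 h3
  rw [h3]
  simpa [h1] using h2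

theorem dx_ne_zero {f : L2} (hf : MemH1 f) (h0 : f ≠ 0) : dx f ≠ 0 := by
  intro h
  apply h0
  have h1 := fourier_dx hf
  rw [h, show (𝓕 (0 : L2) : L2) = 0 from (Lp.fourierTransformₗᵢ ℝ ℂ).map_zero] at h1
  refine eq_zero_of_ae_mul_eq_zero (m := derivSymbol) ?_ ?_
  · filter_upwards [Measure.ae_ne volume (0 : ℝ)] with ξ hξ
    simp [derivSymbol, hξ]
  · filter_upwards [h1, Lp.coeFn_zero ℂ 2 (volume : Measure ℝ)] with ξ h2 h3
    rw [← h2, h3]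
    rfl

theorem fourier_eq_of_lineDerivOp_lineDerivOp {f g : L2}
    (h : -∂_{(1 : ℝ)} (∂_{(1 : ℝ)} (f : 𝓢'(ℝ, ℂ))) + (f : 𝓢'(ℝ, ℂ)) - (g : 𝓢'(ℝ, ℂ)) = 0) :
    ∀ᵐ ξ, (𝓕 g : L2) ξ = (1 - derivSymbol ξ ^ 2) * (𝓕 f : L2) ξ := by
  have hd := derivSymbol_hasTemperateGrowth
  rw [← smulLeftCLM_eq_iff (m := fun ξ => 1 - derivSymbol ξ ^ 2) (by fun_prop),
    ← Lp.fourier_toTemperedDistribution_eq, ← Lp.fourier_toTemperedDistribution_eq]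
  have h1 : (g : 𝓢'(ℝ, ℂ)) = f - ∂_{(1 : ℝ)} (∂_{(1 : ℝ)} (f : 𝓢'(ℝ, ℂ))) := by
    rw [← sub_eq_zero, ← neg_eq_zero, ← h]
    abel
  have h2 (S T : 𝓢'(ℝ, ℂ)) : 𝓕 (S - T) = 𝓕 S - 𝓕 T := map_sub (fourierCLM ℂ 𝓢'(ℝ, ℂ)) S T
  rw [h1, h2, fourier_lineDerivOp, fourier_lineDerivOp,
    smulLeftCLM_smulLeftCLM_apply hd hd]
  have h3 : (fun ξ => 1 - derivSymbol ξ ^ 2) = (fun _ => 1) - derivSymbol * derivSymbol := by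
    ext ξ
    simp [sq]
  rw [h3, smulLeftCLM_sub (by fun_prop) (by fun_prop), sub_apply, smulLeftCLM_const, one_smul]

/-- Integration by parts by Plancherel: `derivSymbol` is purely imaginary, and N - g stands for
-∂ₓ²g. -/
theorem inner_dx_dx {f g N : L2} (hf : MemH1 f) (hg : MemH1 g)
    (h : ∀ᵐ ξ, (𝓕 N : L2) ξ = (1 - derivSymbol ξ ^ 2) * (𝓕 g : L2) ξ) :
    ⟪dx f, dx g⟫ = ⟪f, N - g⟫ := by
  rw [← Lp.inner_fourier_eq, ← Lp.inner_fourier_eq f, L2.inner_def, L2.inner_def,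
    show (𝓕 (N - g) : L2) = 𝓕 N - 𝓕 g from map_sub (Lp.fourierTransformₗᵢ ℝ ℂ) N g]
  refine integral_congr_ae ?_
  filter_upwards [fourier_dx hf, fourier_dx hg, h, Lp.coeFn_sub (𝓕 N : L2) (𝓕 g : L2)]
    with ξ h1 h2 h3 h4
  simp only [h1, h2, h4, Pi.sub_apply, h3, RCLike.inner_apply, map_mul]
  have : (starRingEnd ℂ) (derivSymbol ξ) = - derivSymbol ξ := by
    simp [derivSymbol, Complex.conj_ofNat]
  rw [this]
  ring

/-! ### The propagator -/

theorem fourier_propagator (r : ℝ) (f : L2) :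
    ∀ᵐ ξ, (𝓕 (propagator r f) : L2) ξ = symbol r ξ * (𝓕 f : L2) ξ := by
  rw [propagator, fourier_fourierInv_eq]
  filter_upwards [Lp.coeFn_lpSMul (r := 2) ((memLp_symbol r).toLp (symbol r)) (𝓕 f : L2),
    (memLp_symbol r).coeFn_toLp] with ξ h1 h2
  rw [h1, Pi.smul_apply', h2, smul_eq_mul]

theorem propagator_add_smul (r : ℝ) (f g : L2) (c : ℂ) :
    propagator r (f + c • g) = propagator r f + c • propagator r g := by
  simp only [propagator, FourierTransform.fourier_add, FourierTransform.fourier_smul,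
    ← FourierTransform.fourierInv_smul, ← FourierTransform.fourierInv_add]
  rw [Lp.add_smul, Lp.smul_comm c]

theorem conj_symbol (r ξ : ℝ) : (starRingEnd ℂ) (symbol r ξ) = symbol (-r) ξ := by
  simp [symbol, ← Complex.exp_conj, Complex.conj_ofNat]

theorem inner_propagator_neg (r : ℝ) (f g : L2) :
    ⟪f, propagator (-r) g⟫ = ⟪propagator r f, g⟫ := by
  rw [← Lp.inner_fourier_eq, ← Lp.inner_fourier_eq _ g, L2.inner_def, L2.inner_def]
  refine integral_congr_ae ?_
  filter_upwards [fourier_propagator (-r) g, fourier_propagator r f] with ξ h1 h2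
  simp only [h1, h2, RCLike.inner_apply, map_mul, conj_symbol]
  ring

theorem memH1_propagator {f : L2} (hf : MemH1 f) (r : ℝ) : MemH1 (propagator r f) := by
  rw [memH1_iff] at hf ⊢
  obtain ⟨g, hg⟩ := hf
  refine ⟨(memLp_symbol r).toLp (symbol r) • g, ?_⟩
  filter_upwards [hg, fourier_propagator r f, (memLp_symbol r).coeFn_toLp,
    Lp.coeFn_lpSMul (r := 2) ((memLp_symbol r).toLp (symbol r)) g] with ξ h1 h2 h3 h4
  rw [h4, Pi.smul_apply', h3, h1, h2, smul_eq_mul]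
  ring

/-! ### The nonlinearity -/

/-- The Sobolev embedding `H¹(ℝ) ⊆ L^∞(ℝ)`. -/
theorem MemH1.memLp_top {f : L2} (hf : MemH1 f) : MemLp f ∞ := by
  -- The Fourier transform v of f is integrable, so f is a.e. the inverse Fourier integral of v,
  -- bounded by the L¹ norm of v.
  obtain ⟨v, hv⟩ := MemSobolev.fourier_memL1 (by simp) hf
  have hfv : (f : 𝓢'(ℝ, ℂ)) = 𝓕⁻ (v : 𝓢'(ℝ, ℂ)) := by
    rw [← hv, FourierTransform.fourierInv_fourier_eq]
  have hvi : Integrable (v : ℝ → ℂ) := L1.integrable_coeFn v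
  have hcont : Continuous (𝓕⁻ (v : ℝ → ℂ)) :=
    VectorFourier.fourierIntegral_continuous Real.continuous_fourierChar (by fun_prop) hvi
  have hae : (f : ℝ → ℂ) =ᵐ[volume] 𝓕⁻ (v : ℝ → ℂ) := by
    refine ae_eq_of_integral_schwartz_smul_eq (L2.locallyIntegrable f)
      hcont.locallyIntegrable fun u => ?_
    rw [← Lp.toTemperedDistribution_apply f, hfv, fourierInv_apply, Lp.toTemperedDistribution_apply]
    rw [SchwartzMap.fourierInv_coe]
    have hflip : (-innerₗ ℝ : ℝ →ₗ[ℝ] ℝ →ₗ[ℝ] ℝ).flip = -innerₗ ℝ := by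
      ext
      simp
    have h := VectorFourier.integral_fourierIntegral_smul_eq_flip (L := -innerₗ ℝ)
      Real.continuous_fourierChar (by fun_prop) (u.integrable (μ := volume)) hvi
    rwa [hflip] at h
  refine (memLp_congr_ae hae).2 (memLp_top_of_bound hcont.aestronglyMeasurable
    (∫ x, ‖v x‖) (Filter.Eventually.of_forall fun x => ?_))
  exact VectorFourier.norm_fourierIntegral_le_integral_norm _ _ _ _ _

/-- Boundedness of u puts |u|^(p-1) in L^∞, so the default value in `power` does not occur on H¹. -/
theorem coeFn_power {p : ℝ} (hp : 1 ≤ p) {u : L2} (hu : MemH1 u) :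
    ∀ᵐ x, power p u x = ((‖u x‖ ^ (p - 1) : ℝ) : ℂ) * u x := by
  have h : MemLp (fun x => ((‖u x‖ ^ (p - 1) : ℝ) : ℂ) * u x) 2 (volume : Measure ℝ) := by
    refine MemLp.mul (p := ∞) (q := 2) (Lp.memLp u) ?_
    refine memLp_top_of_bound (C := (eLpNormEssSup u volume).toReal ^ (p - 1)) ?_ ?_
    · have := (Lp.aestronglyMeasurable u).norm.aemeasurable.pow_const (p - 1)
      exact (Complex.measurable_ofReal.comp_aemeasurable this).aestronglyMeasurable
    · have htop : eLpNormEssSup u volume ≠ ∞ := by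
        simpa using hu.memLp_top.eLpNorm_ne_top
      filter_upwards [ae_le_eLpNormEssSup (f := u) (μ := volume)] with x hx
      rw [Complex.norm_real, Real.norm_of_nonneg (by positivity), ← toReal_enorm]
      exact Real.rpow_le_rpow ENNReal.toReal_nonneg (ENNReal.toReal_mono htop hx) (by linarith)
  rw [power, dif_pos h]
  exact h.coeFn_toLp

/-- Needed because the tangent lower bounds may change sign. -/
theorem ofReal_integral_le_lintegral_ofReal {α : Type*} [MeasurableSpace α] {μ : Measure α}
    {g : α → ℝ} (hg : Integrable g μ) :
    ENNReal.ofReal (∫ x, g x ∂μ) ≤ ∫⁻ x, ENNReal.ofReal (g x) ∂μ := by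
  have h := ofReal_integral_eq_lintegral_ofReal hg.pos_part
    (Filter.Eventually.of_forall fun x => le_max_right _ _)
  calc ENNReal.ofReal (∫ x, g x ∂μ) ≤ ENNReal.ofReal (∫ x, max (g x) 0 ∂μ) :=
        ENNReal.ofReal_le_ofReal (integral_mono hg hg.pos_part fun x => le_max_left _ _)
    _ = ∫⁻ x, ENNReal.ofReal (g x) ∂μ := by
        rw [h]
        simp

/-- The tangent inequality for the convex function `‖·‖ ^ (p + 1)`. -/
theorem norm_rpow_add_le_norm_add_rpow {p : ℝ} (hp : 1 ≤ p) (a b : ℂ) :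
    ‖a‖ ^ (p - 1) * ⟪a, a⟫.re + (p + 1) * (‖a‖ ^ (p - 1) * ⟪b, a⟫.re)
      ≤ ‖a + b‖ ^ (p + 1) := by
  -- Young with exponents p + 1 and (p + 1)/p for ‖a + b‖ · ‖a‖^p; Cauchy–Schwarz (`h1`) brings in
  -- the inner products.
  have hY := Real.young_inequality_of_nonneg (norm_nonneg (a + b))
    (Real.rpow_nonneg (norm_nonneg a) p)
    (Real.HolderConjugate.conjExponent (p := p + 1) (by linarith))
  have hconj : Real.conjExponent (p + 1) = (p + 1) / p := by simp [Real.conjExponent]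
  have hp0 : 0 < p := by linarith
  rw [hconj, ← Real.rpow_mul (norm_nonneg a), mul_div_cancel₀ _ hp0.ne'] at hY
  have h1 : ⟪a, a⟫.re + ⟪b, a⟫.re ≤ ‖a + b‖ * ‖a‖ := by
    rw [← Complex.add_re, ← inner_add_left]
    exact (Complex.re_le_norm _).trans (norm_inner_le_norm _ _)
  have h2 : ⟪a, a⟫.re = ‖a‖ ^ 2 := inner_self_eq_norm_sq (𝕜 := ℂ) a
  have h3 : ‖a‖ ^ (p - 1) * ‖a‖ = ‖a‖ ^ p := by
    rw [← Real.rpow_add_one' (norm_nonneg a) (by linarith)]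
    ring_nf
  have h4 : ‖a‖ ^ p * ‖a‖ = ‖a‖ ^ (p + 1) :=
    (Real.rpow_add_one' (norm_nonneg a) (by linarith)).symm
  have h5 : ‖a‖ ^ (p - 1) * (⟪a, a⟫.re + ⟪b, a⟫.re) ≤ ‖a + b‖ * ‖a‖ ^ p := by
    calc _ ≤ ‖a‖ ^ (p - 1) * (‖a + b‖ * ‖a‖) := by gcongr
      _ = _ := by rw [← h3]; ring
  have h6 : ‖a‖ ^ (p - 1) * ⟪a, a⟫.re = ‖a‖ ^ (p + 1) := by
    rw [h2, ← h4, ← h3]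
    ring
  have h7 : (p + 1) * (‖a + b‖ * ‖a‖ ^ p) ≤ ‖a + b‖ ^ (p + 1) + p * ‖a‖ ^ (p + 1) := by
    have := mul_le_mul_of_nonneg_left hY (by linarith : 0 ≤ p + 1)
    refine this.trans_eq ?_
    field_simp
  have h8 := mul_le_mul_of_nonneg_left h5 (by linarith : 0 ≤ p + 1)
  rw [mul_add, h6] at h8
  rw [h6]
  nlinarith [h8, h7]

theorem re_inner_power {p : ℝ} (hp : 1 ≤ p) {u : L2} (hu : MemH1 u) (v : L2) :
    Integrable (fun x => ‖u x‖ ^ (p - 1) * ⟪v x, u x⟫.re) ∧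
    ∫ x, ‖u x‖ ^ (p - 1) * ⟪v x, u x⟫.re = ⟪v, power p u⟫.re := by
  have h : (fun x => ⟪v x, power p u x⟫.re) =ᵐ[volume]
      fun x => ‖u x‖ ^ (p - 1) * ⟪v x, u x⟫.re := by
    filter_upwards [coeFn_power hp hu] with x hx
    rw [hx, ← smul_eq_mul, inner_smul_right, Complex.re_ofReal_mul]
  have hi := L2.integrable_inner (𝕜 := ℂ) v (power p u)
  refine ⟨hi.re.congr h, ?_⟩
  rw [← integral_congr_ae h, L2.inner_def]
  exact integral_re hi

theorem ofReal_le_lintegral_enorm_add_rpow {p : ℝ} (hp : 1 ≤ p) {u : L2} (hu : MemH1 u) (v : L2) :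
    ENNReal.ofReal (⟪u, power p u⟫.re + (p + 1) * ⟪v, power p u⟫.re)
      ≤ ∫⁻ x, ‖(u + v) x‖ₑ ^ (p + 1) := by
  obtain ⟨hi1, he1⟩ := re_inner_power hp hu u
  obtain ⟨hi2, he2⟩ := re_inner_power hp hu v
  rw [← he1, ← he2, ← integral_const_mul, ← integral_add hi1 (hi2.const_mul _)]
  refine (ofReal_integral_le_lintegral_ofReal (hi1.add (hi2.const_mul _))).trans ?_
  refine lintegral_mono_ae ?_
  filter_upwards [Lp.coeFn_add u v] with x hx
  rw [hx, Pi.add_apply, ← ofReal_norm, ENNReal.ofReal_rpow_of_nonneg (norm_nonneg _) (by linarith)]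
  exact ENNReal.ofReal_le_ofReal (norm_rpow_add_le_norm_add_rpow hp _ _)

theorem lintegral_enorm_rpow {p : ℝ} (hp : 1 ≤ p) {u : L2} (hu : MemH1 u) :
    ∫⁻ x, ‖u x‖ₑ ^ (p + 1) = ENNReal.ofReal ⟪u, power p u⟫.re ∧ 0 ≤ ⟪u, power p u⟫.re := by
  obtain ⟨hi, he⟩ := re_inner_power hp hu u
  have h0 : ∀ x, ‖u x‖ ^ (p - 1) * ⟪u x, u x⟫.re = ‖u x‖ ^ (p + 1) := by
    intro x
    rw [show ⟪u x, u x⟫.re = ‖u x‖ ^ 2 from inner_self_eq_norm_sq (𝕜 := ℂ) (u x), ← Real.rpow_natCast,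
      ← Real.rpow_add' (norm_nonneg _) (by push_cast; linarith)]
    congr 1
    push_cast
    ring
  simp only [h0] at hi he
  rw [← he]
  refine ⟨?_, integral_nonneg fun x => by positivity⟩
  rw [ofReal_integral_eq_lintegral_ofReal hi
    (Filter.Eventually.of_forall fun x => by positivity)]
  refine lintegral_congr fun x => ?_
  rw [← ofReal_norm, ENNReal.ofReal_rpow_of_nonneg (norm_nonneg _) (by linarith)]

/-- The integrand of `nonlinearity`. -/
abbrev nonlinearityIntegrand (p : ℝ) (Q : L2) (r : ℝ) : L2 :=
  propagator (-r) (power p (propagator r Q))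

theorem inner_nonlinearity {p : ℝ} {Q : L2} (hi : Integrable (nonlinearityIntegrand p Q)) (f : L2) :
    Integrable (fun r => ⟪propagator r f, power p (propagator r Q)⟫.re) ∧
    ∫ r, ⟪propagator r f, power p (propagator r Q)⟫.re = ⟪f, nonlinearity p Q⟫.re := by
  have h1 : Integrable (fun r => ⟪propagator r f, power p (propagator r Q)⟫) := by
    simpa only [inner_propagator_neg] using hi.const_inner (𝕜 := ℂ) f
  refine ⟨h1.re, ?_⟩
  rw [nonlinearity, ← integral_inner hi f]
  simp only [inner_propagator_neg]
  exact integral_re h1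

theorem strichartz_eq {p : ℝ} (hp : 1 ≤ p) {Q : L2} (hQ : MemH1 Q)
    (hi : Integrable (nonlinearityIntegrand p Q)) :
    strichartz p Q = ENNReal.ofReal ⟪Q, nonlinearity p Q⟫.re := by
  obtain ⟨h1, h2⟩ := inner_nonlinearity hi Q
  have h3 := fun r => lintegral_enorm_rpow hp (memH1_propagator hQ r)
  rw [← h2, ofReal_integral_eq_lintegral_ofReal h1
    (Filter.Eventually.of_forall fun r => (h3 r).2), strichartz]
  exact lintegral_congr fun r => (h3 r).1

/-- The pointwise tangent inequality integrated in x and r; the right side may be infinite. -/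
theorem le_strichartz_add {p : ℝ} (hp : 1 ≤ p) {Q : L2} (hQ : MemH1 Q)
    (hi : Integrable (nonlinearityIntegrand p Q)) (f : L2) (t : ℝ) :
    ENNReal.ofReal (⟪Q, nonlinearity p Q⟫.re + (p + 1) * (t * ⟪f, nonlinearity p Q⟫.re))
      ≤ strichartz p (Q + (t : ℂ) • f) := by
  obtain ⟨h1, h2⟩ := inner_nonlinearity hi Q
  obtain ⟨h3, h4⟩ := inner_nonlinearity hi f
  rw [← h2, ← h4, ← integral_const_mul, ← integral_const_mul,
    ← integral_add h1 ((h3.const_mul _).const_mul _)]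
  refine (ofReal_integral_le_lintegral_ofReal (h1.add ((h3.const_mul _).const_mul _))).trans ?_
  refine lintegral_mono fun r => ?_
  have := ofReal_le_lintegral_enorm_add_rpow hp (memH1_propagator hQ r) ((t : ℂ) • propagator r f)
  rw [propagator_add_smul]
  rwa [inner_smul_left, Complex.conj_ofReal, Complex.re_ofReal_mul] at this

/-! ### Consequences of the Euler–Lagrange equation -/

theorem derivSymbol_sq (ξ : ℝ) : derivSymbol ξ ^ 2 = -(((2 * Real.pi * ξ) ^ 2 : ℝ) : ℂ) := by
  simp only [derivSymbol]
  push_cast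
  linear_combination (2 * Real.pi * ξ : ℂ) ^ 2 * Complex.I_sq

theorem ae_add_mul_sq_ne_zero {a b : ℝ} (h : a ≠ 0 ∨ b ≠ 0) :
    ∀ᵐ ξ : ℝ, a + b * (2 * Real.pi * ξ) ^ 2 ≠ 0 := by
  rcases eq_or_ne b 0 with rfl | hb
  · exact Filter.Eventually.of_forall fun ξ => by simpa using h
  · set y := √(-a / (b * (2 * Real.pi) ^ 2))
    filter_upwards [Measure.ae_ne volume y, Measure.ae_ne volume (-y)] with ξ h1 h2 h3
    have hy : y = |ξ| := by
      have hπ := Real.pi_ne_zero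
      have h4 : -a / (b * (2 * Real.pi) ^ 2) = ξ ^ 2 := by
        field_simp
        linarith
      rw [← Real.sqrt_sq_eq_abs, ← h4]
    rcases abs_choice ξ with h4 | h4
    · exact h1 (by rw [hy, h4])
    · exact h2 (by rw [hy, h4, neg_neg])

/-- The Bochner integral in the Euler–Lagrange equation of a nonzero `Q` exists, as the equation
presupposes: with the value `0` that Mathlib gives to a divergent integral, the
equation would read `-∂ₓ² Q + Q = 0`, which has no nonzero solution in `L²(ℝ)`. -/
theorem SolvesEulerLagrange.integrable {p : ℝ} {Q : L2} (h : SolvesEulerLagrange p Q)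
    (hQ : Q ≠ 0) : Integrable (nonlinearityIntegrand p Q) := by
  by_contra hi
  have hN : nonlinearity p Q = 0 := integral_undef hi
  have h1 := fourier_eq_of_lineDerivOp_lineDerivOp h
  rw [hN, show (𝓕 (0 : L2) : L2) = 0 from (Lp.fourierTransformₗᵢ ℝ ℂ).map_zero] at h1
  refine hQ (eq_zero_of_ae_mul_eq_zero (m := fun ξ => 1 - derivSymbol ξ ^ 2) ?_ ?_)
  · refine Filter.Eventually.of_forall fun ξ => ?_
    rw [derivSymbol_sq, sub_neg_eq_add, ← Complex.ofReal_one, ← Complex.ofReal_add,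
      Complex.ofReal_ne_zero]
    positivity
  · filter_upwards [h1, Lp.coeFn_zero ℂ 2 (volume : Measure ℝ)] with ξ h2 h3
    rw [← h2, h3, Pi.zero_apply]

theorem eq_zero_of_linear_relation {Q N : L2} (hQ : Q ≠ 0)
    (h : ∀ᵐ ξ, (𝓕 N : L2) ξ = (1 - derivSymbol ξ ^ 2) * (𝓕 Q : L2) ξ) {a b : ℝ}
    (h0 : (a : ℂ) • Q + (b : ℂ) • (N - Q) = 0) : a = 0 ∧ b = 0 := by
  by_contra hab
  refine hQ (eq_zero_of_ae_mul_eq_zero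
    (m := fun ξ => ((a + b * (2 * Real.pi * ξ) ^ 2 : ℝ) : ℂ)) ?_ ?_)
  · filter_upwards [ae_add_mul_sq_ne_zero (by tauto : a ≠ 0 ∨ b ≠ 0)] with ξ hξ
    exact Complex.ofReal_ne_zero.2 hξ
  · have h1 := congrArg (Lp.fourierTransformₗᵢ ℝ ℂ) h0
    rw [map_add, map_smul, map_smul, map_sub, map_zero] at h1
    change (a : ℂ) • (𝓕 Q : L2) + (b : ℂ) • ((𝓕 N : L2) - 𝓕 Q) = 0 at h1
    have h2 := Lp.coeFn_zero ℂ 2 (volume : Measure ℝ)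
    rw [← h1] at h2
    filter_upwards [h, h2, Lp.coeFn_add ((a : ℂ) • (𝓕 Q : L2)) ((b : ℂ) • ((𝓕 N : L2) - 𝓕 Q)),
      Lp.coeFn_smul (a : ℂ) (𝓕 Q : L2), Lp.coeFn_smul (b : ℂ) ((𝓕 N : L2) - 𝓕 Q),
      Lp.coeFn_sub (𝓕 N : L2) (𝓕 Q)] with ξ h3 h4 h5 h6 h7 h8
    rw [h5, Pi.add_apply, h6, h7, Pi.smul_apply, Pi.smul_apply, h8, Pi.sub_apply, h3,
      derivSymbol_sq] at h4
    simp only [smul_eq_mul, Pi.zero_apply] at h4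
    push_cast at h4 ⊢
    linear_combination h4

/-! ### The first variation -/

theorem weinstein_denom_eq_ofReal {f : L2} (hf : MemH1 f) (h0 : f ≠ 0) (a b : ℝ) :
    ‖f‖ₑ ^ a * ‖dx f‖ₑ ^ b = ENNReal.ofReal (‖f‖ ^ a * ‖dx f‖ ^ b) ∧ 0 < ‖f‖ ^ a * ‖dx f‖ ^ b := by
  have h1 := norm_pos_iff.2 h0
  have h2 := norm_pos_iff.2 (dx_ne_zero hf h0)
  refine ⟨?_, by positivity⟩
  rw [← ofReal_norm, ← ofReal_norm, ENNReal.ofReal_rpow_of_pos h1, ENNReal.ofReal_rpow_of_pos h2,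
    ← ENNReal.ofReal_mul (by positivity)]

theorem weinstein_eq {p : ℝ} {f : L2} (hf : MemH1 f) (h0 : f ≠ 0) :
    weinstein p f =
      strichartz p f / ENNReal.ofReal (‖f‖ ^ ((p + 7) / 2) * ‖dx f‖ ^ ((p - 5) / 2)) := by
  rw [weinstein, (weinstein_denom_eq_ofReal hf h0 _ _).1]

theorem strichartz_le_bestConst {p : ℝ} (hC : bestConst p ≠ ⊤) {f : L2} (hf : MemH1 f)
    (h0 : f ≠ 0) :
    strichartz p f ≤ ENNReal.ofReal
      ((bestConst p).toReal * (‖f‖ ^ ((p + 7) / 2) * ‖dx f‖ ^ ((p - 5) / 2))) := by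
  have hpos := (weinstein_denom_eq_ofReal hf h0 ((p + 7) / 2) ((p - 5) / 2)).2
  have h1 : weinstein p f ≤ bestConst p := le_iSup₂_of_le f ⟨hf, h0⟩ le_rfl
  rw [weinstein_eq hf h0, ENNReal.div_le_iff (ENNReal.ofReal_pos.2 hpos).ne'
    ENNReal.ofReal_ne_top] at h1
  rwa [ENNReal.ofReal_mul ENNReal.toReal_nonneg, ENNReal.ofReal_toReal hC]

/-- The squared norm is a quadratic polynomial in t, positive at t = 0. -/
theorem hasDerivAt_norm_add_smul_rpow {f : L2} (hf : f ≠ 0) (g : L2) (a : ℝ) :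
    HasDerivAt (fun t : ℝ => ‖f + (t : ℂ) • g‖ ^ a) (‖f‖ ^ a * (a * ⟪g, f⟫.re / ‖f‖ ^ 2)) 0 := by
  have hf' := norm_pos_iff.2 hf
  have h1 : ∀ t : ℝ, ‖f + (t : ℂ) • g‖ ^ a
      = (‖f‖ ^ 2 + 2 * ⟪g, f⟫.re * t + ‖g‖ ^ 2 * t ^ 2) ^ (a / 2) := by
    intro t
    have h2 := norm_add_sq (𝕜 := ℂ) f ((t : ℂ) • g)
    rw [← inner_re_symm, inner_smul_left, Complex.conj_ofReal, norm_smul, Complex.norm_real] at h2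
    have h3 : RCLike.re ((t : ℂ) * ⟪g, f⟫) = t * ⟪g, f⟫.re := Complex.re_ofReal_mul _ _
    have h4 : ‖f‖ ^ 2 + 2 * ⟪g, f⟫.re * t + ‖g‖ ^ 2 * t ^ 2 = ‖f + (t : ℂ) • g‖ ^ 2 := by
      rw [h2, h3, mul_pow, Real.norm_eq_abs, sq_abs]
      ring
    rw [h4, ← Real.rpow_natCast, ← Real.rpow_mul (norm_nonneg _)]
    congr 1
    push_cast
    ring
  simp_rw [h1]
  have h5 : HasDerivAt (fun t : ℝ => ‖f‖ ^ 2 + 2 * ⟪g, f⟫.re * t + ‖g‖ ^ 2 * t ^ 2)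
      (2 * ⟪g, f⟫.re) 0 := by
    refine ((((hasDerivAt_id (0 : ℝ)).const_mul (2 * ⟪g, f⟫.re)).const_add (‖f‖ ^ 2)).add
      ((hasDerivAt_pow 2 (0 : ℝ)).const_mul (‖g‖ ^ 2))).congr_deriv ?_
    simp
  have h6 := h5.rpow_const (p := a / 2) (Or.inl (by simp [hf'.ne']))
  refine h6.congr_deriv ?_
  have h7 : (‖f‖ ^ 2) ^ (a / 2 - 1) = ‖f‖ ^ a / ‖f‖ ^ 2 := by
    rw [Real.rpow_sub_one (by positivity), ← Real.rpow_natCast, ← Real.rpow_mul hf'.le]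
    congr 2
    push_cast
    ring
  simp only [mul_zero, add_zero, ne_eq, OfNat.ofNat_ne_zero, not_false_eq_true, zero_pow, h7]
  ring

/-- The first variation of the Weinstein functional at a maximizer. -/
theorem first_variation {p : ℝ} (hp : 1 ≤ p) {Q : L2} (hQ : MemH1 Q) (h0 : Q ≠ 0)
    (hi : Integrable (nonlinearityIntegrand p Q)) (hC : bestConst p ≠ ⊤)
    (hS : (bestConst p).toReal * (‖Q‖ ^ ((p + 7) / 2) * ‖dx Q‖ ^ ((p - 5) / 2))
      = ⟪Q, nonlinearity p Q⟫.re) {f : L2} (hf : MemH1 f) :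
    (p + 1) * ⟪f, nonlinearity p Q⟫.re = ⟪Q, nonlinearity p Q⟫.re *
      ((p + 7) / 2 * ⟪f, Q⟫.re / ‖Q‖ ^ 2 + (p - 5) / 2 * ⟪dx f, dx Q⟫.re / ‖dx Q‖ ^ 2) := by
  have hd := dx_ne_zero hQ h0
  set N := nonlinearity p Q
  set c := (bestConst p).toReal
  -- Upper bound from C_p minus the tangent line: nonnegative near 0 and zero at 0.
  let G : ℝ → ℝ := fun t => c * (‖Q + (t : ℂ) • f‖ ^ ((p + 7) / 2) *
    ‖dx Q + (t : ℂ) • dx f‖ ^ ((p - 5) / 2)) - (⟪Q, N⟫.re + (p + 1) * ⟪f, N⟫.re * t)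
  have hG0 : G 0 = 0 := by
    simp only [G, Complex.ofReal_zero, zero_smul, add_zero, mul_zero, hS, sub_self]
  have hmin : IsLocalMin G 0 := by
    have hcont : Continuous fun t : ℝ => Q + (t : ℂ) • f := by fun_prop
    have hne : ∀ᶠ t : ℝ in nhds 0, Q + (t : ℂ) • f ≠ 0 :=
      hcont.continuousAt.eventually_ne (by simpa using h0)
    filter_upwards [hne] with t ht
    have h1 := (le_strichartz_add hp hQ hi f t).trans
      (strichartz_le_bestConst hC (memH1_add hQ (memH1_smul hf t)) ht)
    rw [ENNReal.ofReal_le_ofReal_iff (by positivity), dx_add_smul hQ hf] at h1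
    rw [hG0]
    simp only [G]
    linarith
  have hder : HasDerivAt G (⟪Q, N⟫.re *
      ((p + 7) / 2 * ⟪f, Q⟫.re / ‖Q‖ ^ 2 + (p - 5) / 2 * ⟪dx f, dx Q⟫.re / ‖dx Q‖ ^ 2)
      - (p + 1) * ⟪f, N⟫.re) 0 := by
    have h1 := ((hasDerivAt_norm_add_smul_rpow h0 f ((p + 7) / 2)).mul
      (hasDerivAt_norm_add_smul_rpow hd (dx f) ((p - 5) / 2))).const_mul c
    have h2 := ((hasDerivAt_id (0 : ℝ)).const_mul ((p + 1) * ⟪f, N⟫.re)).const_add ⟪Q, N⟫.re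
    refine (h1.sub h2).congr_deriv ?_
    rw [← hS]
    simp only [Complex.ofReal_zero, zero_smul, add_zero]
    ring
  linarith [hmin.hasDerivAt_eq_zero hder]

/-- Schwartz functions lie in H¹ and are dense in L², so f = g may be tested. -/
theorem eq_zero_of_re_inner_eq_zero {g : L2} (h : ∀ f : L2, MemH1 f → ⟪f, g⟫.re = 0) : g = 0 := by
  have hall : ∀ f : L2, ⟪f, g⟫.re = 0 := by
    intro f
    refine DenseRange.induction_on (p := fun f : L2 => ⟪f, g⟫.re = 0)
      (SchwartzMap.denseRange_toLpCLM (E := ℝ) (F := ℂ) (p := 2) (μ := volume)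
        ENNReal.ofNat_ne_top) f ?_ ?_
    · exact isClosed_eq (Complex.continuous_re.comp (by fun_prop)) continuous_const
    · exact fun u => h _ (memH1_toLp u)
  rw [← norm_eq_zero, ← sq_eq_zero_iff, ← inner_self_eq_norm_sq (𝕜 := ℂ)]
  exact hall g

/-! ### The norms of a maximizer -/

theorem sq_eq_of_weinstein_eq {p c n d : ℝ} (hp : 5 < p) (hn : 0 < n) (hd : 0 < d)
    (hdn : d ^ 2 = (p - 5) / (p + 7) * n ^ 2)
    (hc : c * (n ^ ((p + 7) / 2) * d ^ ((p - 5) / 2)) = 2 * (p + 1) / (p + 7) * n ^ 2) :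
    n ^ 2 = (2 * (p + 1) * (p - 5) / ((p + 7) ^ 2 * c)) ^ (2 / (p - 1)) *
      ((p + 7) / (p - 5)) ^ (1 / 2 : ℝ) := by
  have h5 : 0 < p - 5 := by linarith
  have h7 : 0 < p + 7 := by linarith
  have h1 : 0 < p - 1 := by linarith
  have hp1 : 0 < p + 1 := by linarith
  set k := (p - 5) / (p + 7) with hk
  have hk0 : 0 < k := by positivity
  have hdk : d = k ^ (1 / 2 : ℝ) * n := by
    rw [← Real.sqrt_eq_rpow, ← Real.sqrt_sq hn.le, ← Real.sqrt_mul hk0.le, ← hdn,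
      Real.sqrt_sq hd.le]
  have hc0 : c ≠ 0 := by
    rintro rfl
    rw [zero_mul] at hc
    have : 0 < 2 * (p + 1) / (p + 7) * n ^ 2 := by positivity
    exact this.ne hc
  -- Substituting d = k^(1/2) n turns the constraint into a pure power of n² k^(1/2), undone by the
  -- exponent 2/(p - 1).
  have key : 2 * (p + 1) * (p - 5) / ((p + 7) ^ 2 * c)
      = (n ^ 2 * k ^ (1 / 2 : ℝ)) ^ ((p - 1) / 2) := by
    have e1 : n ^ ((p + 7) / 2) * d ^ ((p - 5) / 2)
        = n ^ (2 : ℕ) * n ^ (p - 1) * k ^ ((p - 5) / 4) := by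
      rw [hdk, Real.mul_rpow (by positivity) hn.le, ← Real.rpow_mul hk0.le, ← Real.rpow_natCast,
        ← Real.rpow_add hn, mul_left_comm, ← Real.rpow_add hn, mul_comm]
      congr 2
      · push_cast
        ring
      · ring
    have e2 : (n ^ 2 * k ^ (1 / 2 : ℝ)) ^ ((p - 1) / 2) = n ^ (p - 1) * (k ^ ((p - 5) / 4) * k) := by
      rw [Real.mul_rpow (by positivity) (by positivity), ← Real.rpow_mul hk0.le,
        ← Real.rpow_natCast, ← Real.rpow_mul hn.le, ← Real.rpow_add_one hk0.ne']
      congr 2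
      · push_cast
        ring
      · ring
    have e3 : c * (n ^ (p - 1) * k ^ ((p - 5) / 4)) = 2 * (p + 1) / (p + 7) := by
      rw [e1] at hc
      have : n ^ 2 ≠ 0 := by positivity
      apply mul_right_cancel₀ this
      linarith
    rw [e2, ← mul_assoc, ← mul_right_inj' hc0, ← mul_assoc, e3, hk]
    field_simp
  have e4 : (p - 1) / 2 * (2 / (p - 1)) = 1 := by field_simp
  rw [key, ← Real.rpow_mul (by positivity), e4, Real.rpow_one, mul_assoc,
    ← Real.mul_rpow hk0.le (by positivity), hk, div_mul_div_cancel₀ h7.ne', div_self h5.ne',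
    Real.one_rpow, mul_one]

theorem IsMaximizer.norm_eq {p : ℝ} (hp : 5 < p) {Q : L2} (hM : IsMaximizer p Q)
    (hE : SolvesEulerLagrange p Q) :
    (0 < bestConst p ∧ bestConst p < ⊤) ∧
    ‖Q‖ ^ 2 =
      (2 * (p + 1) * (p - 5) / ((p + 7) ^ 2 * (bestConst p).toReal)) ^ (2 / (p - 1)) *
        ((p + 7) / (p - 5)) ^ (1 / 2 : ℝ) ∧
    ‖dx Q‖ ^ 2 = (p - 5) / (p + 7) * ‖Q‖ ^ 2 ∧
    strichartz p Q = ENNReal.ofReal (2 * (p + 1) / (p + 7) * ‖Q‖ ^ 2) := by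
  obtain ⟨hQ, h0, hW⟩ := hM
  have hp1 : 1 ≤ p := by linarith
  have hi := hE.integrable h0
  have hN := fourier_eq_of_lineDerivOp_lineDerivOp hE
  have hS := strichartz_eq hp1 hQ hi
  have hn := norm_pos_iff.2 h0
  have hd := norm_pos_iff.2 (dx_ne_zero hQ h0)
  have hQQ : ⟪Q, Q⟫.re = ‖Q‖ ^ 2 := inner_self_eq_norm_sq (𝕜 := ℂ) Q
  have hpair : ⟪Q, nonlinearity p Q⟫.re = ‖Q‖ ^ 2 + ‖dx Q‖ ^ 2 := by
    have h1 : ⟪dx Q, dx Q⟫.re = ‖dx Q‖ ^ 2 := inner_self_eq_norm_sq (𝕜 := ℂ) (dx Q)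
    rw [inner_dx_dx hQ hQ hN, inner_sub_right, Complex.sub_re, hQQ] at h1
    linarith
  have hS0 : 0 < ⟪Q, nonlinearity p Q⟫.re := by
    rw [hpair]
    positivity
  have hden := (weinstein_denom_eq_ofReal hQ h0 ((p + 7) / 2) ((p - 5) / 2)).2
  rw [weinstein_eq hQ h0, hS, ← ENNReal.ofReal_div_of_pos hden] at hW
  have hC : bestConst p ≠ ⊤ := hW ▸ ENNReal.ofReal_ne_top
  have hcS : (bestConst p).toReal * (‖Q‖ ^ ((p + 7) / 2) * ‖dx Q‖ ^ ((p - 5) / 2))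
      = ⟪Q, nonlinearity p Q⟫.re := by
    rw [← hW, ENNReal.toReal_ofReal (by positivity), div_mul_cancel₀ _ hden.ne']
  -- a and b are the coefficients of Re⟪f, Q⟫ and Re⟪f, N - Q⟫ in the first variation, once ⟪dx f,
  -- dx Q⟫ is replaced by ⟪f, N - Q⟫ and Re⟪f, N⟫ is split.
  have hrel := eq_zero_of_linear_relation h0 hN
    (a := (p + 1) - ⟪Q, nonlinearity p Q⟫.re * ((p + 7) / 2) / ‖Q‖ ^ 2)
    (b := (p + 1) - ⟪Q, nonlinearity p Q⟫.re * ((p - 5) / 2) / ‖dx Q‖ ^ 2) <| by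
      refine eq_zero_of_re_inner_eq_zero fun f hf => ?_
      have h1 := first_variation hp1 hQ h0 hi hC hcS hf
      rw [inner_dx_dx hf hQ hN, inner_sub_right, Complex.sub_re] at h1
      rw [inner_add_right, inner_smul_right, inner_smul_right, Complex.add_re,
        Complex.re_ofReal_mul, Complex.re_ofReal_mul, inner_sub_right, Complex.sub_re]
      linear_combination h1
  obtain ⟨ha, hb⟩ := hrel
  have h7 : 0 < p + 7 := by linarith
  have h2 : ⟪Q, nonlinearity p Q⟫.re = 2 * (p + 1) / (p + 7) * ‖Q‖ ^ 2 := by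
    rw [sub_eq_zero, eq_div_iff (by positivity)] at ha
    field_simp
    linarith
  have h3 : ‖dx Q‖ ^ 2 = (p - 5) / (p + 7) * ‖Q‖ ^ 2 := by
    rw [hpair] at h2
    field_simp at h2 ⊢
    linarith
  refine ⟨⟨?_, hC.lt_top⟩, ?_, h3, by rw [hS, h2]⟩
  · rw [← hW, ENNReal.ofReal_pos]
    positivity
  · exact sq_eq_of_weinstein_eq hp hn hd h3 (by rw [hcS, h2])

end GNStrichartz

end

theorem lemma4p5 (p : ℝ) (hp : 9 ≤ p) :
    (∀ Q : GNStrichartz.L2,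
      GNStrichartz.IsMaximizer p Q → GNStrichartz.SolvesEulerLagrange p Q →
        (0 < GNStrichartz.bestConst p ∧ GNStrichartz.bestConst p < ⊤) ∧
        ‖Q‖ ^ 2 =
          (2 * (p + 1) * (p - 5) / ((p + 7) ^ 2 * (GNStrichartz.bestConst p).toReal))
              ^ (2 / (p - 1)) * ((p + 7) / (p - 5)) ^ (1 / 2 : ℝ) ∧
        ‖GNStrichartz.dx Q‖ ^ 2 = (p - 5) / (p + 7) * ‖Q‖ ^ 2 ∧
        GNStrichartz.strichartz p Q = ENNReal.ofReal (2 * (p + 1) / (p + 7) * ‖Q‖ ^ 2)) ∧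
    (∀ Q₁ Q₂ : GNStrichartz.L2,
      GNStrichartz.IsMaximizer p Q₁ → GNStrichartz.SolvesEulerLagrange p Q₁ →
      GNStrichartz.IsMaximizer p Q₂ → GNStrichartz.SolvesEulerLagrange p Q₂ →
        ‖Q₁‖ = ‖Q₂‖ ∧ ‖GNStrichartz.dx Q₁‖ = ‖GNStrichartz.dx Q₂‖ ∧
        GNStrichartz.strichartz p Q₁ = GNStrichartz.strichartz p Q₂) := by
  have hp5 : 5 < p := by linarith
  refine ⟨fun Q hM hE => hM.norm_eq hp5 hE, fun Q₁ Q₂ hM₁ hE₁ hM₂ hE₂ => ?_⟩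
  obtain ⟨-, h₁, h₂, h₃⟩ := hM₁.norm_eq hp5 hE₁
  obtain ⟨-, k₁, k₂, k₃⟩ := hM₂.norm_eq hp5 hE₂
  have hQ : ‖Q₁‖ ^ 2 = ‖Q₂‖ ^ 2 := h₁.trans k₁.symm
  have hdQ : ‖GNStrichartz.dx Q₁‖ ^ 2 = ‖GNStrichartz.dx Q₂‖ ^ 2 := by rw [h₂, k₂, hQ]
  exact ⟨(pow_left_inj₀ (norm_nonneg _) (norm_nonneg _) two_ne_zero).1 hQ,
    (pow_left_inj₀ (norm_nonneg _) (norm_nonneg _) two_ne_zero).1 hdQ, by rw [h₃, k₃, hQ]⟩
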